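/- Let $G$ be a finite simple connected graph with vertex set $V$ and edge set $E$, let $K$ be a field, and let $I_G\subset K[s_e : e\in E]$ be the toric ideal of $G$, i.e. the kernel of the $K$-algebra homomorphism $K[s_e : e\in E]\to K[t_i : i\in V]$, $s_{\{i,j\}}\mapsto t_it_j$. A binomial is a difference $u-v$ of two distinct monomials $u,v$. A binomial $f=u-v\in I_G$ is called primitive (that is, it lies in the Graver basis of $I_G$) if there is no binomial $g=u'-v'\in I_G$ with $g\neq 0$, $g\neq f$, such that $u'\mid u$ and $v'\mid v$. For an even closed walk $w=(i_1,i_2,\ldots,i_{2p},i_1)$ in $G$ with edges $e_k=\{i_k,i_{k+1}\}$, $1\le k\le 2p$ (where $i_{2p+1}=i_1$), put $f_w=\prod_{k=1}^p s_{e_{2k-1}}-\prod_{k=1}^p s_{e_{2k}}$; for a vertex $i$ let $\#_w(i)$ be the number of $l\in\{1,\ldots,2p\}$ with $i_l=i$; and for a walk $w'$ let $V(w')$ be the set of vertices on $w'$. Then a binomial $f\in I_G$ is primitive if and only if $f=f_w$ for some even closed walk $w=(i_1,\ldots,i_{2p},i_1)$ in $G$ such that (i) $\#_w(i)\in\{1,2\}$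 for every $i\in V(w)$; and (ii) for every $j\in V(w)$ with $\#_w(j)=2$, say $j=i_l=i_{l'}$ with $1\le l<l'\le 2p$, the closed walks $w_1^j=(i_l,\ldots,i_{l'})$ and $w_2^j=(i_{l'},\ldots,i_{2p},i_1,\ldots,i_l)$ both have odd length and $V(w_1^j)\cap V(w_2^j)=\{j\}$. -/

import Mathlib

namespace GraverGraph

open MvPolynomial

variable {V : Type*} (K : Type*) [Field K] (G : SimpleGraph V)

/-- The homomorphism `π : K[s] → K[t]` sending the variable `s_e` of an edge `e = {i, j}` of `G`
to `t_i * t_j`. -/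
noncomputable def edgeHom : MvPolynomial G.edgeSet K →ₐ[K] MvPolynomial V K :=
  aeval fun e => Sym2.lift ⟨fun i j => X i * X j, fun _ _ => mul_comm _ _⟩ (e : Sym2 V)

/-- The toric ideal `I_G = ker π`. -/
noncomputable def toricIdeal : Ideal (MvPolynomial G.edgeSet K) :=
  RingHom.ker (edgeHom K G)

variable {K G}

/-- The pure difference `s^a - s^b` of the monomials with exponent vectors `a` and `b`. -/
noncomputable def monoDiff (a b : G.edgeSet →₀ ℕ) : MvPolynomial G.edgeSet K :=
  monomial a 1 - monomial b 1

/-- A binomial is a difference of two distinct monomials. -/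
def IsBinomial (f : MvPolynomial G.edgeSet K) : Prop :=
  ∃ a b : G.edgeSet →₀ ℕ, a ≠ b ∧ f = monoDiff a b

/-- A binomial `f = u - v` in `I_G` is primitive if there is no binomial `g = u' - v'` in `I_G`
with `g ≠ 0`, `g ≠ f`, such that `u' ∣ u` and `v' ∣ v`. -/
def IsPrimitive (f : MvPolynomial G.edgeSet K) : Prop :=
  f ∈ toricIdeal K G ∧
    ∃ a b : G.edgeSet →₀ ℕ, a ≠ b ∧ f = monoDiff a b ∧
      ¬ ∃ a' b' : G.edgeSet →₀ ℕ,
        (monoDiff a' b' : MvPolynomial G.edgeSet K) ∈ toricIdeal K G ∧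
        (monoDiff a' b' : MvPolynomial G.edgeSet K) ≠ 0 ∧
        (monoDiff a' b' : MvPolynomial G.edgeSet K) ≠ f ∧
        (monomial a' 1 : MvPolynomial G.edgeSet K) ∣ monomial a 1 ∧
        (monomial b' 1 : MvPolynomial G.edgeSet K) ∣ monomial b 1

/-- The `k`-th edge of a walk, counted from `k = 0`. -/
def walkEdge {x y : V} (w : G.Walk x y) (k : ℕ) (hk : k < w.length) : G.edgeSet :=
  ⟨s(w.getVert k, w.getVert (k + 1)), w.adj_getVert_succ hk⟩

variable (K) in
/-- The binomial `f_w` of an even closed walk `w = (e_0, e_1, …, e_{2p-1})`: the product of the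
variables of the edges `e_0, e_2, …, e_{2p-2}` (the first, third, … edges of `w`)
minus the product of the variables of the edges `e_1, e_3, …, e_{2p-1}`. -/
noncomputable def walkBinomial {x : V} (w : G.Walk x x) : MvPolynomial G.edgeSet K :=
  (∏ k : Fin (w.length / 2), X (walkEdge w (2 * k) (by omega))) -
    ∏ k : Fin (w.length / 2), X (walkEdge w (2 * k + 1) (by omega))

/-- `#_w(i)`: how often the closed walk `w` visits `i` before it returns to its starting point at
its last step. -/
noncomputable def visits {x : V} (w : G.Walk x x) (i : V) : ℕ :=
  {l : ℕ | l < w.length ∧ w.getVert l = i}.ncard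

/-- Every vertex of `w` is visited once or twice, and for every vertex `j` that is visited twice,
at the positions `l < l'`, the closed walk along `w` from position `l` to position `l'` and the
closed walk along `w` from position `l'` through the starting point of `w` to position `l` are odd
and have only the vertex `j` in common. -/
def GraverCondition {x : V} (w : G.Walk x x) : Prop :=
  (∀ i ∈ w.support, visits w i = 1 ∨ visits w i = 2) ∧
    ∀ j ∈ w.support, visits w j = 2 →
      ∀ l l' : ℕ, l < l' → l' < w.length → w.getVert l = j → w.getVert l' = j →
        Odd ((w.take l').drop l).length ∧
        Odd ((w.drop l').append (w.take l)).length ∧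
        {i | i ∈ ((w.take l').drop l).support} ∩
          {i | i ∈ ((w.drop l').append (w.take l)).support} = {j}

end GraverGraph

/-!
A binomial `s^a - s^b` lies in the toric ideal exactly when the multigraphs with edge multiplicities
`a` and `b` have the same vertex degrees (`monoDiff_mem_toricIdeal`), so primitivity says that the
pair `(a, b)` is minimal among the nontrivial pairs with equal degrees (`IsPrimitivePair`).

The binomial of an even closed walk `(i_0, …, i_n)`, with `i_n = i_0`, has as `a` and `b` the edges at
even and at odd positions. A set `S` of positions yields a pair below it, and this pair has equal
degrees if and only if `S` is balanced: the sum over `k ∈ S` of `(-1)^k ([i_k = v] + [i_{k+1} = v])`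
vanishes for every vertex `v` (`vertexDegrees_eq_iff`). On an interval of positions the sum
telescopes (`sum_Ico_alternating`). The condition on the walk says that equal vertices are at odd
distance and that two pairs of equal vertices never interleave (`IsOddNoncrossing`).

If `(a, b)` is primitive, a walk that uses edges of `a` and `b` alternately can be prolonged until it
closes up after an even number of steps (`exists_concat_le`), and by minimality it then uses up `a`
and `b`. By minimality again no proper nonempty set of positions is balanced. A stretch between
equal vertices at even distance would be such a set, and so would the two stretches `[p, q)` and
`[r, s)` for interleaved pairs `i_p = i_r`, `i_q = i_s`.

Conversely, every pair below that of the walk comes from a set of positions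
(`exists_subset_sum_stepExp`), and under the condition a nonempty balanced set of positions contains
every position (`IsOddNoncrossing.eq_range_of_balanced`). Indeed its indicator function changes by
the same amount at the two positions of a repeated vertex and does not change elsewhere; the changes
alternate in sign, so two equal ones have another change between them, which is ruled out for an
innermost pair.
-/

namespace GraverGraph

open MvPolynomial

variable {V : Type*} {K : Type*} [Field K] {G : SimpleGraph V}

/-! ### Primitive pairs of exponent vectors -/

/-- The exponent vector of `t_i * t_j`, for a pair `{i, j}`. -/
noncomputable def endpoints (e : Sym2 V) : V →₀ ℕ :=
  Sym2.lift ⟨fun i j => Finsupp.single i 1 + Finsupp.single j 1, fun _ _ => add_comm _ _⟩ e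

/-- The degrees of the vertices in the multigraph with edge multiplicities `a`; equivalently the
exponent vector of `π(s^a)`. -/
noncomputable def vertexDegrees : (G.edgeSet →₀ ℕ) →ₗ[ℕ] (V →₀ ℕ) :=
  Finsupp.linearCombination ℕ fun e => endpoints (e : Sym2 V)

lemma edgeHom_monomial (a : G.edgeSet →₀ ℕ) :
    edgeHom K G (monomial a 1) = monomial (vertexDegrees a) 1 := by
  have h : ∀ e : Sym2 V,
      Sym2.lift ⟨fun i j => (X i * X j : MvPolynomial V K), fun _ _ => mul_comm _ _⟩ e =
        monomial (endpoints e) 1 := by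
    refine Sym2.ind fun i j => ?_
    simp [endpoints, X, monomial_mul]
  rw [edgeHom, aeval_monomial, vertexDegrees, Finsupp.linearCombination_apply,
    monomial_finsupp_sum_index]
  simp only [h, monomial_pow, one_pow, map_one, one_mul]

lemma monoDiff_mem_toricIdeal {a b : G.edgeSet →₀ ℕ} :
    (monoDiff a b : MvPolynomial G.edgeSet K) ∈ toricIdeal K G ↔
      vertexDegrees a = vertexDegrees b := by
  rw [toricIdeal, RingHom.mem_ker, monoDiff, map_sub, edgeHom_monomial, edgeHom_monomial,
    sub_eq_zero]
  exact monomial_left_inj one_ne_zero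

lemma monoDiff_eq_zero {a b : G.edgeSet →₀ ℕ} :
    (monoDiff a b : MvPolynomial G.edgeSet K) = 0 ↔ a = b := by
  rw [monoDiff, sub_eq_zero]
  exact monomial_left_inj one_ne_zero

/-- A pair of distinct exponent vectors with the same vertex degrees that has no smaller nontrivial
pair of this kind below it. -/
structure IsPrimitivePair (a b : G.edgeSet →₀ ℕ) : Prop where
  ne : a ≠ b
  degrees : vertexDegrees a = vertexDegrees b
  eq_of_le : ∀ a' ≤ a, ∀ b' ≤ b, vertexDegrees a' = vertexDegrees b' → a' ≠ b' →
    a' = a ∧ b' = b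

/-- In characteristic two `s^a - s^b` is also `s^b - s^a`, which is why only vectors below `a` and
`b` are compared. -/
lemma eq_of_monoDiff_eq_of_le {a b a' b' : G.edgeSet →₀ ℕ} (hab : a ≠ b) (ha : a' ≤ a)
    (hb : b' ≤ b) (h : (monoDiff a' b' : MvPolynomial G.edgeSet K) = monoDiff a b) :
    a' = a ∧ b' = b := by
  classical
  have hc := fun c => congrArg (coeff c) h
  simp only [monoDiff, coeff_sub, coeff_monomial] at hc
  have h1 := hc a
  have h2 := hc b
  rw [if_neg hab.symm, if_pos rfl] at h1
  rw [if_neg hab, if_pos rfl] at h2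
  by_cases e1 : a' = a
  · refine ⟨e1, ?_⟩
    by_contra e2
    simp [e1, hab, e2] at h2
  · have e2 : b' = a := by
      by_contra e2
      simp [e1, e2] at h1
    have e3 : a' = b := by
      by_contra e3
      have : b' ≠ b := e2 ▸ hab
      simp [e3, this] at h2
    exact absurd (le_antisymm (e2 ▸ hb) (e3 ▸ ha)) hab

lemma isPrimitivePair_of_forall {a b : G.edgeSet →₀ ℕ}
    (hI : (monoDiff a b : MvPolynomial G.edgeSet K) ∈ toricIdeal K G) (hab : a ≠ b)
    (h : ¬ ∃ a' b' : G.edgeSet →₀ ℕ,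
        (monoDiff a' b' : MvPolynomial G.edgeSet K) ∈ toricIdeal K G ∧
        (monoDiff a' b' : MvPolynomial G.edgeSet K) ≠ 0 ∧
        (monoDiff a' b' : MvPolynomial G.edgeSet K) ≠ monoDiff a b ∧
        (monomial a' 1 : MvPolynomial G.edgeSet K) ∣ monomial a 1 ∧
        (monomial b' 1 : MvPolynomial G.edgeSet K) ∣ monomial b 1) :
    IsPrimitivePair a b := by
  refine ⟨hab, monoDiff_mem_toricIdeal.1 hI, fun a' ha b' hb hd hne => ?_⟩
  by_contra hcon
  refine h ⟨a', b', monoDiff_mem_toricIdeal.2 hd, fun h0 => hne (monoDiff_eq_zero.1 h0),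
    fun heq => hcon (eq_of_monoDiff_eq_of_le hab ha hb heq), ?_, ?_⟩
  · exact monomial_dvd_monomial.2 ⟨Or.inr ha, dvd_rfl⟩
  · exact monomial_dvd_monomial.2 ⟨Or.inr hb, dvd_rfl⟩

lemma IsPrimitivePair.isPrimitive {a b : G.edgeSet →₀ ℕ} (h : IsPrimitivePair a b) :
    IsPrimitive (monoDiff a b : MvPolynomial G.edgeSet K) := by
  refine ⟨monoDiff_mem_toricIdeal.2 h.degrees, a, b, h.ne, rfl, ?_⟩
  rintro ⟨a', b', hI, h0, hne, ha, hb⟩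
  have ha' : a' ≤ a := (monomial_dvd_monomial.1 ha).1.resolve_left one_ne_zero
  have hb' : b' ≤ b := (monomial_dvd_monomial.1 hb).1.resolve_left one_ne_zero
  obtain ⟨rfl, rfl⟩ := h.eq_of_le a' ha' b' hb' (monoDiff_mem_toricIdeal.1 hI)
    fun e => h0 (monoDiff_eq_zero.2 e)
  exact hne rfl

/-! ### Exponent vectors of sets of steps of a walk -/

/-- The exponent vector of the variable of the `k`-th edge of `w`; it is `0` beyond the end of
`w`. -/
noncomputable def stepExp {x y : V} (w : G.Walk x y) (k : ℕ) : G.edgeSet →₀ ℕ :=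
  if hk : k < w.length then Finsupp.single (walkEdge w k hk) 1 else 0

lemma stepExp_of_lt {x y : V} (w : G.Walk x y) {k : ℕ} (hk : k < w.length) :
    stepExp w k = Finsupp.single (walkEdge w k hk) 1 := dif_pos hk

lemma stepExp_ne_zero {x y : V} (w : G.Walk x y) {k : ℕ} (hk : k < w.length) :
    stepExp w k ≠ 0 := by
  rw [stepExp_of_lt w hk]
  simp

/-- The exponent vector of the edges at the even positions in `S`. -/
noncomputable def evenExp {x y : V} (w : G.Walk x y) (S : Finset ℕ) : G.edgeSet →₀ ℕ :=
  ∑ k ∈ S with Even k, stepExp w k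

/-- The exponent vector of the edges at the odd positions in `S`. -/
noncomputable def oddExp {x y : V} (w : G.Walk x y) (S : Finset ℕ) : G.edgeSet →₀ ℕ :=
  ∑ k ∈ S with ¬ Even k, stepExp w k

lemma evenExp_mono {x y : V} (w : G.Walk x y) {S T : Finset ℕ} (h : S ⊆ T) :
    evenExp w S ≤ evenExp w T :=
  Finset.sum_le_sum_of_subset (Finset.filter_subset_filter _ h)

lemma oddExp_mono {x y : V} (w : G.Walk x y) {S T : Finset ℕ} (h : S ⊆ T) :
    oddExp w S ≤ oddExp w T :=
  Finset.sum_le_sum_of_subset (Finset.filter_subset_filter _ h)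

lemma evenExp_union {x y : V} (w : G.Walk x y) {S T : Finset ℕ} (h : Disjoint S T) :
    evenExp w (S ∪ T) = evenExp w S + evenExp w T := by
  rw [evenExp, Finset.filter_union, Finset.sum_union (Finset.disjoint_filter_filter h)]
  rfl

lemma oddExp_union {x y : V} (w : G.Walk x y) {S T : Finset ℕ} (h : Disjoint S T) :
    oddExp w (S ∪ T) = oddExp w S + oddExp w T := by
  rw [oddExp, Finset.filter_union, Finset.sum_union (Finset.disjoint_filter_filter h)]
  rfl

lemma eq_empty_of_exp_eq_zero {x y : V} (w : G.Walk x y) {S : Finset ℕ}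
    (hS : S ⊆ Finset.range w.length) (h0 : evenExp w S = 0) (h1 : oddExp w S = 0) : S = ∅ := by
  refine Finset.eq_empty_of_forall_notMem fun k hk => ?_
  have hlt := Finset.mem_range.1 (hS hk)
  rcases em (Even k) with he | he
  · exact stepExp_ne_zero w hlt
      (Finset.sum_eq_zero_iff.1 h0 k (Finset.mem_filter.2 ⟨hk, he⟩))
  · exact stepExp_ne_zero w hlt
      (Finset.sum_eq_zero_iff.1 h1 k (Finset.mem_filter.2 ⟨hk, he⟩))

lemma walkBinomial_eq_monoDiff {x : V} (w : G.Walk x x) (hw : Even w.length) :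
    walkBinomial K w =
      monoDiff (evenExp w (Finset.range w.length)) (oddExp w (Finset.range w.length)) := by
  have hX : ∀ k (hk : k < w.length),
      (X (walkEdge w k hk) : MvPolynomial G.edgeSet K) = monomial (stepExp w k) 1 := by
    intro k hk
    rw [stepExp_of_lt w hk]
    rfl
  have key : ∀ m, ((∑ k ∈ Finset.range (2 * m) with Even k, stepExp w k) =
        ∑ k ∈ Finset.range m, stepExp w (2 * k)) ∧
      (∑ k ∈ Finset.range (2 * m) with ¬ Even k, stepExp w k) =
        ∑ k ∈ Finset.range m, stepExp w (2 * k + 1) := by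
    intro m
    induction m with
    | zero => simp
    | succ m ih =>
      simp only [Finset.sum_filter] at ih ⊢
      rw [show 2 * (m + 1) = 2 * m + 1 + 1 by ring]
      simp only [Finset.sum_range_succ, ih.1, ih.2]
      simp
  have hl : 2 * (w.length / 2) = w.length := Nat.two_mul_div_two_of_even hw
  have := key (w.length / 2)
  rw [hl] at this
  rw [walkBinomial, monoDiff, evenExp, oddExp, this.1, this.2, monomial_sum_one, monomial_sum_one,
    Finset.prod_range, Finset.prod_range]
  simp only [hX]

/-! ### Alternating sums along a walk -/

lemma vertexDegrees_stepExp {x y : V} [DecidableEq V] (w : G.Walk x y) {k : ℕ}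
    (hk : k < w.length) (v : V) :
    ((vertexDegrees (stepExp w k) v : ℕ) : ℤ) =
      (if w.getVert k = v then 1 else 0) + if w.getVert (k + 1) = v then 1 else 0 := by
  rw [stepExp_of_lt w hk, vertexDegrees, Finsupp.linearCombination_single, one_smul]
  simp [walkEdge, endpoints, Finsupp.single_apply]

/-- Position `k` contributes its two ends, with sign `(-1) ^ k`, to the difference of the degrees. -/
lemma vertexDegrees_sub {x y : V} [DecidableEq V] (w : G.Walk x y) {S : Finset ℕ}
    (hS : S ⊆ Finset.range w.length) (v : V) :
    ((vertexDegrees (evenExp w S) v : ℕ) : ℤ) - (vertexDegrees (oddExp w S) v : ℕ) =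
      ∑ k ∈ S, (-1) ^ k * ((if w.getVert k = v then 1 else 0) +
        if w.getVert (k + 1) = v then 1 else 0) := by
  rw [evenExp, oddExp, map_sum, map_sum, Finsupp.finsetSum_apply, Finsupp.finsetSum_apply,
    Nat.cast_sum, Nat.cast_sum, ← Finset.sum_filter_add_sum_filter_not S (fun k => Even k),
    sub_eq_add_neg, ← Finset.sum_neg_distrib]
  congr 1 <;> refine Finset.sum_congr rfl fun k hk => ?_ <;> rw [Finset.mem_filter] at hk <;>
    rw [vertexDegrees_stepExp w (Finset.mem_range.1 (hS hk.1))]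
  · rw [hk.2.neg_one_pow, one_mul]
  · rw [(Nat.not_even_iff_odd.1 hk.2).neg_one_pow, neg_one_mul]

lemma vertexDegrees_eq_iff {x y : V} [DecidableEq V] (w : G.Walk x y) {S : Finset ℕ}
    (hS : S ⊆ Finset.range w.length) :
    vertexDegrees (evenExp w S) = vertexDegrees (oddExp w S) ↔
      ∀ v, ∑ k ∈ S, (-1 : ℤ) ^ k * ((if w.getVert k = v then 1 else 0) +
        if w.getVert (k + 1) = v then 1 else 0) = 0 := by
  simp only [← vertexDegrees_sub w hS, sub_eq_zero, Nat.cast_inj, Finsupp.ext_iff]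

lemma sum_Ico_alternating (g : ℕ → ℤ) {l m : ℕ} (h : l ≤ m) :
    ∑ k ∈ Finset.Ico l m, (-1) ^ k * (g k + g (k + 1)) = (-1) ^ l * g l - (-1) ^ m * g m := by
  induction m, h using Nat.le_induction with
  | base => simp
  | succ m h ih =>
    rw [Finset.sum_Ico_succ_top h, ih]
    ring

/-! ### The condition on the walk, in terms of positions -/

/-- Equal terms among `g 0, …, g (n - 1)` are at odd distance, and two pairs of equal terms never
interleave. -/
structure IsOddNoncrossing (g : ℕ → V) (n : ℕ) : Prop where
  odd : ∀ l l', l < l' → l' < n → g l = g l' → Odd (l' - l)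
  noncrossing : ∀ p q r s, p < q → q < r → r < s → s < n → g p = g r → g q ≠ g s

lemma mem_support_drop_take {x y : V} (w : G.Walk x y) {l l' : ℕ} (hl : l ≤ l')
    (hl' : l' ≤ w.length) (i : V) :
    i ∈ ((w.take l').drop l).support ↔ ∃ m, l ≤ m ∧ m ≤ l' ∧ w.getVert m = i := by
  simp only [SimpleGraph.Walk.mem_support_iff_exists_getVert, SimpleGraph.Walk.drop_getVert,
    SimpleGraph.Walk.take_getVert, SimpleGraph.Walk.drop_length, SimpleGraph.Walk.take_length]
  constructor
  · rintro ⟨m, rfl, hm⟩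
    exact ⟨l' ⊓ (l + m), by omega, by omega, rfl⟩
  · rintro ⟨m, h1, h2, rfl⟩
    exact ⟨m - l, by congr 1; omega, by omega⟩

lemma mem_support_drop_append_take {x : V} (w : G.Walk x x) {l l' : ℕ} (hl : l ≤ w.length)
    (hl' : l' ≤ w.length) (i : V) :
    i ∈ ((w.drop l').append (w.take l)).support ↔
      ∃ m, (m ≤ l ∨ l' ≤ m) ∧ m ≤ w.length ∧ w.getVert m = i := by
  rw [SimpleGraph.Walk.mem_support_append_iff]
  simp only [SimpleGraph.Walk.mem_support_iff_exists_getVert, SimpleGraph.Walk.drop_getVert,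
    SimpleGraph.Walk.take_getVert, SimpleGraph.Walk.drop_length, SimpleGraph.Walk.take_length]
  constructor
  · rintro (⟨m, rfl, hm⟩ | ⟨m, rfl, hm⟩)
    · exact ⟨l' + m, by omega, by omega, rfl⟩
    · exact ⟨l ⊓ m, by omega, by omega, rfl⟩
  · rintro ⟨m, h1 | h1, h2, rfl⟩
    · exact Or.inr ⟨m, by congr 1; omega, by omega⟩
    · exact Or.inl ⟨m - l', by congr 1; omega, by omega⟩

lemma GraverCondition.isOddNoncrossing {x : V} {w : G.Walk x x} (h : GraverCondition w) :
    IsOddNoncrossing w.getVert w.length := by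
  have two : ∀ l l', l < l' → l' < w.length → w.getVert l = w.getVert l' →
      visits w (w.getVert l) = 2 := by
    intro l l' hl hl' he
    refine (h.1 _ (w.getVert_mem_support l)).resolve_left fun h1 => ?_
    obtain ⟨k, hk⟩ := Set.ncard_eq_one.1 h1
    have e1 : l ∈ ({k} : Set ℕ) := hk ▸ ⟨hl.trans hl', rfl⟩
    have e2 : l' ∈ ({k} : Set ℕ) := hk ▸ ⟨hl', he.symm⟩
    rw [Set.mem_singleton_iff] at e1 e2
    omega
  have hodd : ∀ l l', l < l' → l' < w.length → w.getVert l = w.getVert l' → Odd (l' - l) := by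
    intro l l' hl hl' he
    have := (h.2 _ (w.getVert_mem_support l) (two l l' hl hl' he) l l' hl hl' rfl he.symm).1
    rwa [SimpleGraph.Walk.drop_length, SimpleGraph.Walk.take_length, min_eq_left hl'.le] at this
  refine ⟨hodd, fun p q r s hpq hqr hrs hs hpr hqs => ?_⟩
  have hr : r < w.length := hrs.trans hs
  have hmeet := (h.2 _ (w.getVert_mem_support p) (two p r (hpq.trans hqr) hr hpr) p r
    (hpq.trans hqr) hr rfl hpr.symm).2.2
  have hq : w.getVert q ∈ ({w.getVert p} : Set V) := by
    rw [← hmeet]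
    exact ⟨(mem_support_drop_take w (hpq.trans hqr).le hr.le _).2 ⟨q, hpq.le, hqr.le, rfl⟩,
      (mem_support_drop_append_take w (by omega) hr.le _).2
        ⟨s, Or.inr hrs.le, hs.le, hqs.symm⟩⟩
  rw [Set.mem_singleton_iff] at hq
  -- Three visits to one vertex cannot be pairwise at odd distance.
  have o1 := hodd p q hpq (hqr.trans hr) hq.symm
  have o2 := hodd q r hqr hr (hq.trans hpr)
  have o3 := hodd p r (hpq.trans hqr) hr hpr
  grind

lemma IsOddNoncrossing.graverCondition {x : V} {w : G.Walk x x} (hw : Even w.length)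
    (h0 : 0 < w.length) (h : IsOddNoncrossing w.getVert w.length) : GraverCondition w := by
  have hfin : ∀ i, {l : ℕ | l < w.length ∧ w.getVert l = i}.Finite := fun i =>
    (Set.finite_lt_nat w.length).subset fun l hl => hl.1
  have hend : w.getVert w.length = w.getVert 0 := by simp
  constructor
  · intro i hi
    obtain ⟨m, rfl, hm⟩ := SimpleGraph.Walk.mem_support_iff_exists_getVert.1 hi
    have hpos : 0 < visits w (w.getVert m) := by
      rw [visits, Set.ncard_pos (hfin _)]
      rcases hm.lt_or_eq with hm | rfl
      · exact ⟨m, hm, rfl⟩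
      · exact ⟨0, h0, hend.symm⟩
    have hle : visits w (w.getVert m) ≤ 2 := by
      by_contra! hlt
      obtain ⟨a, b, c, ha, hb, hc, hab, hac, hbc⟩ := (Set.two_lt_ncard_iff (hfin _)).1 hlt
      have key : ∀ a b, a < w.length ∧ w.getVert a = w.getVert m →
          b < w.length ∧ w.getVert b = w.getVert m → a ≠ b → (Even a ↔ ¬ Even b) := by
        intro a b ha hb hab
        rcases hab.lt_or_gt with hlt | hlt
        · have := h.odd a b hlt hb.1 (ha.2.trans hb.2.symm)
          grind
        · have := h.odd b a hlt ha.1 (hb.2.trans ha.2.symm)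
          grind
      have k1 := key a b ha hb hab
      have k2 := key a c ha hc hac
      have k3 := key b c hb hc hbc
      tauto
    omega
  · intro j _ _ l l' hl hl' hjl hjl'
    have hodd := h.odd l l' hl hl' (hjl.trans hjl'.symm)
    refine ⟨?_, ?_, ?_⟩
    · rwa [SimpleGraph.Walk.drop_length, SimpleGraph.Walk.take_length, min_eq_left hl'.le]
    · rw [SimpleGraph.Walk.length_append, SimpleGraph.Walk.drop_length,
        SimpleGraph.Walk.take_length]
      grind
    · ext k
      simp only [Set.mem_inter_iff, Set.mem_ofPred_eq, Set.mem_singleton_iff,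
        mem_support_drop_take w hl.le hl'.le,
        mem_support_drop_append_take w (hl.trans hl').le hl'.le]
      constructor
      · rintro ⟨⟨m, hm1, hm2, hm⟩, ⟨m', hm'1, hm'2, hm'⟩⟩
        by_contra hkj
        -- Position `w.length` is position `0` again, so the second visit may be taken below
        -- `w.length`.
        obtain ⟨m'', hm''1, hm''2, hm''⟩ :
            ∃ m'', (m'' ≤ l ∨ l' ≤ m'') ∧ m'' < w.length ∧ w.getVert m'' = k := by
          rcases hm'2.lt_or_eq with hlt | rfl
          · exact ⟨m', hm'1, hlt, hm'⟩
          · exact ⟨0, Or.inl (Nat.zero_le l), h0, hend.symm.trans hm'⟩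
        have n1 : m ≠ l := by rintro rfl; exact hkj (hm.symm.trans hjl)
        have n2 : m ≠ l' := by rintro rfl; exact hkj (hm.symm.trans hjl')
        have n3 : m'' ≠ l := by rintro rfl; exact hkj (hm''.symm.trans hjl)
        have n4 : m'' ≠ l' := by rintro rfl; exact hkj (hm''.symm.trans hjl')
        rcases hm''1 with hlt | hlt
        · exact h.noncrossing m'' l m l' (by omega) (by omega) (by omega) hl'
            (hm''.trans hm.symm) (hjl.trans hjl'.symm)
        · exact h.noncrossing l m l' m'' (by omega) (by omega) (by omega) hm''2
            (hjl.trans hjl'.symm) (hm.trans hm''.symm)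
      · rintro rfl
        exact ⟨⟨l, le_rfl, hl.le, hjl⟩, ⟨l, Or.inl le_rfl, (hl.trans hl').le, hjl⟩⟩

/-! ### The walk of a primitive binomial -/

lemma stepExp_concat {x y z : V} (w : G.Walk x y) (h : G.Adj y z) {k : ℕ} (hk : k < w.length) :
    stepExp (w.concat h) k = stepExp w k := by
  rw [stepExp_of_lt w hk, stepExp_of_lt (w.concat h) (by simp; omega)]
  congr 1
  apply Subtype.ext
  simp only [walkEdge, SimpleGraph.Walk.concat_eq_append, SimpleGraph.Walk.getVert_append]
  rw [if_pos hk]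
  split_ifs with h1
  · rfl
  · obtain h2 : k + 1 = w.length := by omega
    simp [h2]

lemma stepExp_concat_length {x y z : V} (w : G.Walk x y) (h : G.Adj y z) :
    stepExp (w.concat h) w.length = Finsupp.single ⟨s(y, z), h⟩ 1 := by
  rw [stepExp_of_lt (w.concat h) (by simp)]
  congr 1
  apply Subtype.ext
  simp [walkEdge, SimpleGraph.Walk.concat_eq_append, SimpleGraph.Walk.getVert_append]

lemma evenExp_concat {x y z : V} (w : G.Walk x y) (h : G.Adj y z) :
    evenExp (w.concat h) (Finset.range (w.concat h).length) =
      evenExp w (Finset.range w.length) +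
        if Even w.length then Finsupp.single ⟨s(y, z), h⟩ 1 else 0 := by
  rw [evenExp, evenExp, SimpleGraph.Walk.length_concat, Finset.sum_filter, Finset.sum_filter,
    Finset.sum_range_succ, stepExp_concat_length]
  congr 1
  refine Finset.sum_congr rfl fun k hk => ?_
  rw [stepExp_concat w h (Finset.mem_range.1 hk)]

lemma oddExp_concat {x y z : V} (w : G.Walk x y) (h : G.Adj y z) :
    oddExp (w.concat h) (Finset.range (w.concat h).length) =
      oddExp w (Finset.range w.length) +
        if ¬ Even w.length then Finsupp.single ⟨s(y, z), h⟩ 1 else 0 := by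
  rw [oddExp, oddExp, SimpleGraph.Walk.length_concat, Finset.sum_filter, Finset.sum_filter,
    Finset.sum_range_succ, stepExp_concat_length]
  congr 1
  refine Finset.sum_congr rfl fun k hk => ?_
  rw [stepExp_concat w h (Finset.mem_range.1 hk)]

/-- An edge vector with positive degree at `y` contains an edge at `y`. -/
lemma exists_single_le {c : G.edgeSet →₀ ℕ} {y : V} (h : 0 < vertexDegrees c y) :
    ∃ (z : V) (hz : G.Adj y z), Finsupp.single (⟨s(y, z), hz⟩ : G.edgeSet) 1 ≤ c := by
  classical
  rw [vertexDegrees, Finsupp.linearCombination_apply, Finsupp.sum, Finsupp.finsetSum_apply] at h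
  obtain ⟨⟨e, he⟩, hec, hpos⟩ := Finset.exists_ne_zero_of_sum_ne_zero h.ne'
  have hone : Finsupp.single (⟨e, he⟩ : G.edgeSet) 1 ≤ c := by
    rw [Finsupp.single_le_iff]
    exact Nat.one_le_iff_ne_zero.2 (Finsupp.mem_support_iff.1 hec)
  induction e using Sym2.ind with
  | _ i j =>
    have hij : i = y ∨ j = y := by
      by_contra! hne
      simp [endpoints, hne.1, hne.2] at hpos
    rcases hij with rfl | rfl
    · exact ⟨j, he, hone⟩
    · refine ⟨i, SimpleGraph.Adj.symm he, ?_⟩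
      convert hone using 3
      exact Subtype.ext Sym2.eq_swap

lemma degree_evenExp_add_oddExp {x y : V} (w : G.Walk x y) :
    (evenExp w (Finset.range w.length)).degree + (oddExp w (Finset.range w.length)).degree =
      w.length := by
  rw [← map_add, evenExp, oddExp, Finset.sum_filter_add_sum_filter_not, map_sum]
  rw [Finset.sum_congr rfl (g := fun _ => 1), Finset.sum_const, Finset.card_range, smul_eq_mul,
    mul_one]
  intro k hk
  rw [stepExp_of_lt w (Finset.mem_range.1 hk), Finsupp.degree_single]

lemma vertexDegrees_evenExp_sub_oddExp {x y : V} [DecidableEq V] (w : G.Walk x y) (v : V) :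
    ((vertexDegrees (evenExp w (Finset.range w.length)) v : ℕ) : ℤ) -
        (vertexDegrees (oddExp w (Finset.range w.length)) v : ℕ) =
      (if x = v then 1 else 0) - (-1) ^ w.length * if y = v then 1 else 0 := by
  have := sum_Ico_alternating (fun k => if w.getVert k = v then 1 else 0) (Nat.zero_le w.length)
  rw [vertexDegrees_sub w subset_rfl, Finset.range_eq_Ico, this]
  simp

/-- A walk that alternates between the edges of `a` and of `b` can be prolonged, unless it is
closed of even length: at its end the unused edges of the colour that is due outnumber those of the
other colour. -/
lemma exists_concat_le {a b : G.edgeSet →₀ ℕ} (hd : vertexDegrees a = vertexDegrees b) {x y : V}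
    (w : G.Walk x y) (ha : evenExp w (Finset.range w.length) ≤ a)
    (hb : oddExp w (Finset.range w.length) ≤ b) (hw : ¬ (Even w.length ∧ x = y)) :
    ∃ (z : V) (h : G.Adj y z), evenExp (w.concat h) (Finset.range (w.concat h).length) ≤ a ∧
      oddExp (w.concat h) (Finset.range (w.concat h).length) ≤ b := by
  classical
  have hy := vertexDegrees_evenExp_sub_oddExp w y
  have hdy : vertexDegrees a y = vertexDegrees b y := by rw [hd]
  have ea := congrArg (fun c => vertexDegrees c y) (add_tsub_cancel_of_le ha)
  have eb := congrArg (fun c => vertexDegrees c y) (add_tsub_cancel_of_le hb)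
  simp only [map_add, Finsupp.add_apply] at ea eb
  simp only [evenExp_concat, oddExp_concat]
  rcases em (Even w.length) with he | he
  · have hxy : x ≠ y := fun h => hw ⟨he, h⟩
    rw [he.neg_one_pow, if_neg hxy, if_pos rfl] at hy
    obtain ⟨z, hz, hle⟩ := exists_single_le
      (c := a - evenExp w (Finset.range w.length)) (y := y) (by omega)
    refine ⟨z, hz, ?_, by simpa [he] using hb⟩
    rw [if_pos he]
    exact (add_le_add_right hle _).trans (add_tsub_cancel_of_le ha).le
  · rw [(Nat.not_even_iff_odd.1 he).neg_one_pow, if_pos rfl] at hy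
    obtain ⟨z, hz, hle⟩ := exists_single_le
      (c := b - oddExp w (Finset.range w.length)) (y := y) (by split_ifs at hy <;> omega)
    refine ⟨z, hz, by simpa [he] using ha, ?_⟩
    rw [if_pos he]
    exact (add_le_add_right hle _).trans (add_tsub_cancel_of_le hb).le

lemma exists_closed_walk_le {a b : G.edgeSet →₀ ℕ} (hd : vertexDegrees a = vertexDegrees b)
    (ha0 : a ≠ 0) :
    ∃ (x : V) (w : G.Walk x x), Even w.length ∧ 0 < w.length ∧
      evenExp w (Finset.range w.length) ≤ a ∧ oddExp w (Finset.range w.length) ≤ b := by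
  by_contra! hno
  have grow : ∀ n, ∃ (x y : V) (w : G.Walk x y), w.length = n + 1 ∧
      evenExp w (Finset.range w.length) ≤ a ∧ oddExp w (Finset.range w.length) ≤ b := by
    intro n
    induction n with
    | zero =>
      obtain ⟨⟨e, he⟩, hea⟩ := Finsupp.ne_iff.1 ha0
      induction e using Sym2.ind with
      | _ i j =>
        have hadj : G.Adj i j := he
        refine ⟨i, j, (SimpleGraph.Walk.nil : G.Walk i i).concat hadj, by simp, ?_, ?_⟩
        · rw [evenExp_concat]
          simpa [evenExp, Nat.one_le_iff_ne_zero] using hea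
        · rw [oddExp_concat]
          simp [oddExp]
    | succ n ih =>
      obtain ⟨x, y, w, hn, ha, hb⟩ := ih
      obtain ⟨z, h, ha', hb'⟩ := exists_concat_le hd w ha hb (by
        rintro ⟨he, rfl⟩
        exact hno x w he (by omega) ha hb)
      exact ⟨x, z, w.concat h, by rw [SimpleGraph.Walk.length_concat, hn], ha', hb'⟩
  obtain ⟨x, y, w, hn, ha, hb⟩ := grow (a.degree + b.degree)
  have h1 := Finsupp.degree_mono ha
  have h2 := Finsupp.degree_mono hb
  have h3 := degree_evenExp_add_oddExp w
  omega

lemma eq_zero_of_vertexDegrees_eq_zero {a : G.edgeSet →₀ ℕ} (h : vertexDegrees a = 0) : a = 0 := by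
  by_contra hne
  obtain ⟨⟨e, he⟩, hea⟩ := Finsupp.ne_iff.1 hne
  induction e using Sym2.ind with
  | _ i j =>
    have hle : Finsupp.single (⟨s(i, j), he⟩ : G.edgeSet) 1 ≤ a := by
      rw [Finsupp.single_le_iff]
      exact Nat.one_le_iff_ne_zero.2 hea
    have := congrArg vertexDegrees (add_tsub_cancel_of_le hle)
    rw [map_add, h, vertexDegrees, Finsupp.linearCombination_single, one_smul] at this
    simpa [endpoints] using DFunLike.congr_fun this i

/-- The edges of a primitive pair form one alternating closed walk. -/
lemma IsPrimitivePair.exists_closed_walk {a b : G.edgeSet →₀ ℕ} (h : IsPrimitivePair a b) :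
    ∃ (x : V) (w : G.Walk x x), Even w.length ∧ 0 < w.length ∧
      evenExp w (Finset.range w.length) = a ∧ oddExp w (Finset.range w.length) = b := by
  classical
  have ha0 : a ≠ 0 := by
    rintro rfl
    refine h.ne (eq_zero_of_vertexDegrees_eq_zero ?_).symm
    rw [← h.degrees, map_zero]
  obtain ⟨x, w, he, hpos, ha, hb⟩ := exists_closed_walk_le h.degrees ha0
  refine ⟨x, w, he, hpos, ?_⟩
  have hdeg : vertexDegrees (evenExp w (Finset.range w.length)) =
      vertexDegrees (oddExp w (Finset.range w.length)) := by
    ext v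
    have := vertexDegrees_evenExp_sub_oddExp w v
    rw [he.neg_one_pow, one_mul, sub_self, sub_eq_zero] at this
    exact_mod_cast this
  refine h.eq_of_le _ ha _ hb hdeg fun heq => ?_
  -- If both halves of the walk were equal, removing them from `a` and `b` would contradict
  -- primitivity.
  obtain ⟨c, hc⟩ := exists_add_of_le ha
  obtain ⟨d, hd⟩ := exists_add_of_le hb
  have hcd : vertexDegrees c = vertexDegrees d := by
    have := h.degrees
    rw [hc, hd, map_add, map_add, hdeg] at this
    exact add_left_cancel this
  obtain ⟨e1, -⟩ := h.eq_of_le c (hc ▸ le_add_self) d (hd ▸ le_add_self) hcd (by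
    rintro rfl
    exact h.ne (by rw [hc, hd, heq]))
  have hzero : evenExp w (Finset.range w.length) = 0 := by
    rw [e1] at hc
    exact right_eq_add.1 hc
  have := eq_empty_of_exp_eq_zero w subset_rfl hzero (heq ▸ hzero)
  rw [Finset.range_eq_empty_iff] at this
  omega

/-- In the walk of a primitive pair no proper nonempty set of positions is balanced. -/
lemma IsPrimitivePair.eq_range_of_balanced {x y : V} {w : G.Walk x y}
    (h : IsPrimitivePair (evenExp w (Finset.range w.length)) (oddExp w (Finset.range w.length)))
    {S : Finset ℕ} (hS : S ⊆ Finset.range w.length) (hne : S.Nonempty)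
    (hbal : vertexDegrees (evenExp w S) = vertexDegrees (oddExp w S)) :
    S = Finset.range w.length := by
  have he := evenExp_union w (Finset.disjoint_sdiff (s := S) (t := Finset.range w.length))
  have ho := oddExp_union w (Finset.disjoint_sdiff (s := S) (t := Finset.range w.length))
  rw [Finset.union_sdiff_of_subset hS] at he ho
  have hbal' : vertexDegrees (evenExp w (Finset.range w.length \ S)) =
      vertexDegrees (oddExp w (Finset.range w.length \ S)) := by
    have := h.degrees
    rw [he, ho, map_add, map_add, hbal] at this
    exact add_left_cancel this
  have hsub : Finset.range w.length \ S ⊆ Finset.range w.length := Finset.sdiff_subset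
  by_cases hTne : evenExp w (Finset.range w.length \ S) = oddExp w (Finset.range w.length \ S)
  · -- Then the pair of `S` itself is nontrivial, hence everything, and the complement is empty.
    have hSne : evenExp w S ≠ oddExp w S := fun hSe => h.ne (by rw [he, ho, hSe, hTne])
    obtain ⟨e1, e2⟩ := h.eq_of_le _ (evenExp_mono w hS) _ (oddExp_mono w hS) hbal hSne
    rw [← e1] at he
    rw [← e2] at ho
    have := eq_empty_of_exp_eq_zero w hsub (left_eq_add.1 he) (left_eq_add.1 ho)
    exact hS.antisymm (Finset.sdiff_eq_empty_iff_subset.1 this)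
  · obtain ⟨e1, e2⟩ := h.eq_of_le _ (evenExp_mono w hsub) _ (oddExp_mono w hsub) hbal' hTne
    rw [e1] at he
    rw [e2] at ho
    have := eq_empty_of_exp_eq_zero w hS (right_eq_add.1 he) (right_eq_add.1 ho)
    exact absurd this hne.ne_empty

/-- A violation of either condition yields a proper nonempty balanced set of positions: a closed
stretch of even length, or two stretches joining the same two vertices. -/
lemma IsPrimitivePair.isOddNoncrossing {x y : V} {w : G.Walk x y}
    (h : IsPrimitivePair (evenExp w (Finset.range w.length)) (oddExp w (Finset.range w.length))) :
    IsOddNoncrossing w.getVert w.length := by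
  classical
  have hodd : ∀ l l', l < l' → l' < w.length → w.getVert l = w.getVert l' → Odd (l' - l) := by
    intro l l' hl hl' heq
    by_contra hev
    rw [Nat.not_odd_iff_even] at hev
    -- A closed stretch of even length is a balanced set of positions.
    have hS : Finset.Ico l l' ⊆ Finset.range w.length := fun k hk => by
      rw [Finset.mem_Ico] at hk
      exact Finset.mem_range.2 (by omega)
    have hbal := h.eq_range_of_balanced hS ⟨l, by simp [hl]⟩ <|
      (vertexDegrees_eq_iff w hS).2 fun v => by
      have hpow : (-1 : ℤ) ^ l' = (-1) ^ l := by
        rw [← Nat.add_sub_cancel' hl.le, pow_add, hev.neg_one_pow, mul_one]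
      rw [sum_Ico_alternating (fun k => if w.getVert k = v then 1 else 0) hl.le, heq, hpow,
        sub_self]
    have : l' ∈ Finset.Ico l l' := hbal ▸ Finset.mem_range.2 hl'
    simp at this
  refine ⟨hodd, fun p q r s hpq hqr hrs hs hpr hqs => ?_⟩
  have neg : ∀ l l', l < l' → Odd (l' - l) → (-1 : ℤ) ^ l' = -(-1) ^ l := by
    intro l l' hl ho
    rw [← Nat.add_sub_cancel' hl.le, pow_add, ho.neg_one_pow, mul_neg_one]
  have n1 := neg p r (by omega) (hodd p r (by omega) (by omega) hpr)
  have n2 := neg q s (by omega) (hodd q s (by omega) hs hqs)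
  -- The stretch from `p` to `q`, followed by the reverse of the one from `r` to `s`, is closed and
  -- alternates.
  have hS : Finset.Ico p q ∪ Finset.Ico r s ⊆ Finset.range w.length := fun k hk => by
    rw [Finset.mem_union, Finset.mem_Ico, Finset.mem_Ico] at hk
    exact Finset.mem_range.2 (by omega)
  have hdisj : Disjoint (Finset.Ico p q) (Finset.Ico r s) :=
    Finset.disjoint_left.2 fun k hk hk' => by
      rw [Finset.mem_Ico] at hk hk'
      omega
  have hbal := h.eq_range_of_balanced hS ⟨p, by simp [hpq]⟩ <| (vertexDegrees_eq_iff w hS).2 fun v => by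
    rw [Finset.sum_union hdisj,
      sum_Ico_alternating (fun k => if w.getVert k = v then 1 else 0) hpq.le,
      sum_Ico_alternating (fun k => if w.getVert k = v then 1 else 0) hrs.le, hpr, hqs, n1, n2]
    ring
  have : q ∈ Finset.Ico p q ∪ Finset.Ico r s := hbal ▸ Finset.mem_range.2 (by omega)
  rw [Finset.mem_union, Finset.mem_Ico, Finset.mem_Ico] at this
  omega

/-! ### Balanced sets of positions under the condition -/

/-- Under a cyclic sequence of even length whose equal terms are at odd distance and do not
interleave, a nonempty balanced set of positions is everything. With `s` the indicator of `S`, put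
`d k = s k - s (k - 1)` cyclically: balance says that `d` vanishes at unrepeated terms and agrees at
the two positions of a repeated one. As the nonzero values of `d` alternate in sign, an innermost
repeated term with `d ≠ 0` is impossible, so `d = 0`. -/
lemma IsOddNoncrossing.eq_range_of_balanced [DecidableEq V] {g : ℕ → V} {n : ℕ} (hn : Even n)
    (h : IsOddNoncrossing g n) (hg : g n = g 0) {S : Finset ℕ} (hS : S ⊆ Finset.range n)
    (hne : S.Nonempty)
    (hbal : ∀ v, ∑ k ∈ S, (-1 : ℤ) ^ k * ((if g k = v then 1 else 0) +
      if g (k + 1) = v then 1 else 0) = 0) :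
    S = Finset.range n := by
  obtain ⟨m, rfl⟩ : ∃ m, n = m + 1 := by
    obtain ⟨k, hk⟩ := hne
    have := Finset.mem_range.1 (hS hk)
    exact ⟨n - 1, by omega⟩
  set s : ℕ → ℤ := fun k => if k ∈ S then 1 else 0 with hs
  -- `t k` is the value of `s` at the cyclic predecessor of `k`.
  set t : ℕ → ℤ := fun k => if k = 0 then s m else s (k - 1) with ht
  have hm : Odd m := by grind
  have hsum : ∀ v, ∑ k ∈ Finset.range (m + 1) with g k = v, (-1 : ℤ) ^ k * (s k - t k) = 0 := by
    intro v
    have e1 : ∑ k ∈ Finset.range (m + 1), (-1 : ℤ) ^ k * s k * ((if g k = v then 1 else 0) +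
        if g (k + 1) = v then 1 else 0) = 0 := by
      refine Eq.trans ?_ (hbal v)
      rw [← Finset.sum_subset hS]
      · refine Finset.sum_congr rfl fun k hk => ?_
        simp [hs, hk]
      · intro k _ hk
        simp [hs, hk]
    have e2 : ∑ k ∈ Finset.range (m + 1), (-1 : ℤ) ^ k * s k * (if g (k + 1) = v then 1 else 0) =
        - ∑ k ∈ Finset.range (m + 1), (-1 : ℤ) ^ k * t k * (if g k = v then 1 else 0) := by
      rw [Finset.sum_range_succ, Finset.sum_range_succ' _ m, hg, hm.neg_one_pow, neg_add,
        ← Finset.sum_neg_distrib]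
      congr 1
      · refine Finset.sum_congr rfl fun k _ => ?_
        simp only [ht, pow_succ, Nat.add_sub_cancel, Nat.succ_ne_zero, if_false]
        ring
      · simp only [ht, pow_zero, if_true]
        ring
    rw [Finset.sum_filter]
    simp only [mul_add, Finset.sum_add_distrib] at e1
    rw [e2, ← sub_eq_add_neg, ← Finset.sum_sub_distrib] at e1
    refine Eq.trans ?_ e1
    refine Finset.sum_congr rfl fun k _ => ?_
    split_ifs <;> ring
  -- A change of `s` at `l` is met by an equal one at a second position of the same term.
  have hpair : ∀ l < m + 1, s l - t l ≠ 0 →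
      ∃ l' < m + 1, l' ≠ l ∧ g l' = g l ∧ s l' - t l' = s l - t l := by
    intro l hl hd
    have hv := hsum (g l)
    have hmem : l ∈ (Finset.range (m + 1)).filter fun k => g k = g l := by simp [hl]
    by_cases hex : ∃ l' < m + 1, l' ≠ l ∧ g l' = g l
    · obtain ⟨l', hl', hne', hgl⟩ := hex
      have par : ∀ i j, i < m + 1 → j < m + 1 → i ≠ j → g i = g j → (Even i ↔ ¬ Even j) := by
        intro i j hi hj hij he
        rcases hij.lt_or_gt with hlt | hlt
        · have := h.odd i j hlt hj he
          grind
        · have := h.odd j i hlt hi he.symm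
          grind
      have hfil : ((Finset.range (m + 1)).filter fun k => g k = g l) = {l, l'} := by
        ext k
        simp only [Finset.mem_filter, Finset.mem_range, Finset.mem_insert, Finset.mem_singleton]
        constructor
        · rintro ⟨hk, hgk⟩
          by_contra! hk'
          have := par k l hk hl hk'.1 hgk
          have := par k l' hk hl' hk'.2 (hgk.trans hgl.symm)
          have := par l' l hl' hl hne' hgl
          tauto
        · rintro (rfl | rfl)
          · exact ⟨hl, rfl⟩
          · exact ⟨hl', hgl⟩
      rw [hfil, Finset.sum_pair hne'.symm] at hv
      refine ⟨l', hl', hne', hgl, ?_⟩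
      have := par l' l hl' hl hne' hgl
      rcases em (Even l) with he | he
      · have ho : Odd l' := Nat.not_even_iff_odd.1 fun hc => this.1 hc he
        rw [he.neg_one_pow, ho.neg_one_pow] at hv
        linarith
      · rw [(this.2 he).neg_one_pow, (Nat.not_even_iff_odd.1 he).neg_one_pow] at hv
        linarith
    · push Not at hex
      have hfil : ((Finset.range (m + 1)).filter fun k => g k = g l) = {l} := by
        ext k
        simp only [Finset.mem_filter, Finset.mem_range, Finset.mem_singleton]
        constructor
        · rintro ⟨hk, hgk⟩
          by_contra hkl
          exact hex k hk hkl hgk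
        · rintro rfl
          exact ⟨hl, rfl⟩
      rw [hfil, Finset.sum_singleton] at hv
      exact absurd ((mul_eq_zero.1 hv).resolve_left (pow_ne_zero _ (by norm_num))) hd
  have hno : ∀ c l, l + c < m + 1 → 0 < c → g l = g (l + c) → s l - t l ≠ 0 →
      s (l + c) - t (l + c) ≠ s l - t l := by
    intro c
    induction c using Nat.strong_induction_on with
    | _ c ih =>
      intro l hl hc hgl hd heq
      -- By induction there is no change of `s` strictly between the two positions.
      have hmid : ∀ k, l < k → k < l + c → s k - t k = 0 := by
        intro k hk1 hk2
        by_contra hk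
        obtain ⟨k', hk', hkk', hgk, hdk⟩ := hpair k (by omega) hk
        have par1 : k' ≠ l := by
          rintro rfl
          have := h.odd _ _ hk1 (by omega) hgk
          have := h.odd _ _ hk2 hl (hgk.symm.trans hgl)
          have := h.odd _ _ (by omega) hl hgl
          grind
        have par2 : k' ≠ l + c := by
          rintro rfl
          have := h.odd _ _ hk1 (by omega) (hgl.trans hgk)
          have := h.odd _ _ hk2 hl hgk.symm
          have := h.odd _ _ (by omega) hl hgl
          grind
        rcases lt_or_gt_of_ne par1 with hlt | hlt
        · exact h.noncrossing k' l k (l + c) hlt hk1 hk2 hl hgk hgl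
        · rcases lt_or_gt_of_ne par2 with hlt' | hlt'
          · rcases lt_or_gt_of_ne hkk' with hlt'' | hlt''
            · obtain ⟨e, rfl⟩ := Nat.exists_eq_add_of_lt hlt''
              exact ih (e + 1) (by omega) k' (by omega) (by omega) hgk (hdk ▸ hk) hdk.symm
            · obtain ⟨e, rfl⟩ := Nat.exists_eq_add_of_lt hlt''
              exact ih (e + 1) (by omega) k (by omega) (by omega) hgk.symm hk hdk
          · exact h.noncrossing l k (l + c) k' hk1 hk2 hlt' hk' hgl hgk.symm
      have hconst : ∀ e, l + e < l + c → s (l + e) = s l := by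
        intro e
        induction e with
        | zero => simp
        | succ e ihe =>
          intro he
          have h1 := hmid (l + (e + 1)) (by omega) he
          have h2 : t (l + (e + 1)) = s (l + e) := by simp [ht, ← add_assoc]
          rw [h2, ihe (by omega)] at h1
          linarith
      obtain ⟨e, rfl⟩ : ∃ e, c = e + 1 := ⟨c - 1, by omega⟩
      have h2 : t (l + (e + 1)) = s l := by
        rw [← hconst e (by omega)]
        simp [ht, ← add_assoc]
      rw [h2] at heq
      have s01 : ∀ k, s k = 0 ∨ s k = 1 := fun k => by
        simp only [hs]
        split_ifs <;> simp
      have t01 : t l = 0 ∨ t l = 1 := by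
        simp only [ht]
        split_ifs <;> exact s01 _
      rcases s01 l with h3 | h3 <;> rcases s01 (l + (e + 1)) with h4 | h4 <;>
        rcases t01 with h5 | h5 <;> rw [h3, h4, h5] at heq <;> rw [h3, h5] at hd <;> omega
  have hd0 : ∀ l < m + 1, s l = t l := by
    intro l hl
    by_contra hd
    have hd' : s l - t l ≠ 0 := sub_ne_zero.2 hd
    obtain ⟨l', hl', hne', hgl, hdl⟩ := hpair l hl hd'
    rcases hne'.lt_or_gt with hlt | hlt
    · obtain ⟨e, rfl⟩ := Nat.exists_eq_add_of_lt hlt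
      exact hno (e + 1) l' (by omega) (by omega) hgl (hdl ▸ hd') hdl.symm
    · obtain ⟨e, rfl⟩ := Nat.exists_eq_add_of_lt hlt
      exact hno (e + 1) l (by omega) (by omega) hgl.symm hd' hdl
  have hconst : ∀ k < m + 1, s k = s 0 := by
    intro k
    induction k with
    | zero => simp
    | succ k ih =>
      intro hk
      rw [hd0 _ hk, ← ih (by omega)]
      simp [ht]
  obtain ⟨k, hk⟩ := hne
  have hk1 : s 0 = 1 := by
    rw [← hconst k (Finset.mem_range.1 (hS hk))]
    simp [hs, hk]
  refine hS.antisymm fun j hj => ?_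
  have := hconst j (Finset.mem_range.1 hj)
  rw [hk1] at this
  by_contra hjS
  simp [hs, hjS] at this

/-- A vector below the sum of the basis vectors at the positions in `T` is the sum over a subset of
`T`. -/
lemma exists_subset_sum_stepExp {x y : V} (w : G.Walk x y) (T : Finset ℕ) (a : G.edgeSet →₀ ℕ)
    (ha : a ≤ ∑ k ∈ T, stepExp w k) : ∃ S ⊆ T, a = ∑ k ∈ S, stepExp w k := by
  induction T using Finset.induction_on generalizing a with
  | empty => exact ⟨∅, subset_rfl, by simpa using ha⟩
  | insert k T hk ih =>
    rw [Finset.sum_insert hk] at ha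
    by_cases hle : a ≤ ∑ k ∈ T, stepExp w k
    · obtain ⟨S, hS, rfl⟩ := ih a hle
      exact ⟨S, hS.trans (Finset.subset_insert _ _), rfl⟩
    · -- Then the step `k` is needed, so its edge occurs in `a`.
      have hlt : stepExp w k ≤ a := by
        by_contra hnot
        refine hle fun e => ?_
        have hae := ha e
        by_cases hkl : k < w.length
        · rw [stepExp_of_lt w hkl] at hnot hae
          rw [Finsupp.single_le_iff] at hnot
          by_cases hee : walkEdge w k hkl = e
          · subst hee
            omega
          · simpa [Finsupp.single_apply, hee] using hae
        · simp [stepExp, hkl] at hnot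
      obtain ⟨S, hS, hSe⟩ := ih (a - stepExp w k) (tsub_le_iff_left.2 ha)
      refine ⟨insert k S, Finset.insert_subset_insert _ hS, ?_⟩
      rw [Finset.sum_insert fun h => hk (hS h), ← hSe, add_tsub_cancel_of_le hlt]

lemma IsOddNoncrossing.isPrimitivePair {x : V} {w : G.Walk x x} (hw : Even w.length)
    (h : IsOddNoncrossing w.getVert w.length)
    (hne : evenExp w (Finset.range w.length) ≠ oddExp w (Finset.range w.length)) :
    IsPrimitivePair (evenExp w (Finset.range w.length)) (oddExp w (Finset.range w.length)) := by
  classical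
  refine ⟨hne, ?_, fun a' ha b' hb hd hab => ?_⟩
  · ext v
    have := vertexDegrees_evenExp_sub_oddExp w v
    rw [hw.neg_one_pow, one_mul, sub_self, sub_eq_zero] at this
    exact_mod_cast this
  · obtain ⟨A, hA, rfl⟩ := exists_subset_sum_stepExp w _ a' ha
    obtain ⟨B, hB, rfl⟩ := exists_subset_sum_stepExp w _ b' hb
    have hA' : ∀ k ∈ A, k < w.length ∧ Even k := fun k hk => by simpa using hA hk
    have hB' : ∀ k ∈ B, k < w.length ∧ ¬ Even k := fun k hk => by simpa using hB hk
    have eA : ∑ k ∈ A, stepExp w k = evenExp w (A ∪ B) := by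
      rw [evenExp]
      congr 1
      ext k
      have := hA' k
      have := hB' k
      simp only [Finset.mem_filter, Finset.mem_union]
      tauto
    have eB : ∑ k ∈ B, stepExp w k = oddExp w (A ∪ B) := by
      rw [oddExp]
      congr 1
      ext k
      have := hA' k
      have := hB' k
      simp only [Finset.mem_filter, Finset.mem_union]
      tauto
    rw [eA, eB] at hd hab ⊢
    have hS : A ∪ B ⊆ Finset.range w.length := fun k hk => by
      rcases Finset.mem_union.1 hk with hk | hk
      · exact Finset.mem_range.2 (hA' k hk).1
      · exact Finset.mem_range.2 (hB' k hk).1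
    have hSne : (A ∪ B).Nonempty := by
      rw [Finset.nonempty_iff_ne_empty]
      intro h0
      exact hab (by simp [h0, evenExp, oddExp])
    have := h.eq_range_of_balanced hw (by simp) hS hSne ((vertexDegrees_eq_iff w hS).1 hd)
    rw [this]
    exact ⟨rfl, rfl⟩

end GraverGraph

/-- A binomial of the toric ideal of a finite simple connected graph is primitive if and only if
it is the binomial of an even closed walk that satisfies the condition. -/
theorem theorem3p1 {V : Type*} [Finite V] (K : Type*) [Field K] (G : SimpleGraph V)
    (hG : G.Connected) (f : MvPolynomial G.edgeSet K) (hf : GraverGraph.IsBinomial f)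
    (hfI : f ∈ GraverGraph.toricIdeal K G) :
    GraverGraph.IsPrimitive f ↔
      ∃ (x : V) (w : G.Walk x x), Even w.length ∧ GraverGraph.walkBinomial K w = f ∧
        GraverGraph.GraverCondition w := by
  constructor
  · rintro ⟨hI, a, b, hab, rfl, hmin⟩
    have hprim := GraverGraph.isPrimitivePair_of_forall hI hab hmin
    obtain ⟨x, w, he, hpos, rfl, rfl⟩ := hprim.exists_closed_walk
    exact ⟨x, w, he, GraverGraph.walkBinomial_eq_monoDiff w he,
      hprim.isOddNoncrossing.graverCondition he hpos⟩
  · rintro ⟨x, w, he, rfl, hcond⟩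
    rw [GraverGraph.walkBinomial_eq_monoDiff w he] at hf ⊢
    refine (hcond.isOddNoncrossing.isPrimitivePair he fun heq => ?_).isPrimitive
    obtain ⟨a, b, hab, hf⟩ := hf
    exact hab (GraverGraph.monoDiff_eq_zero.1 (hf.symm.trans (GraverGraph.monoDiff_eq_zero.2 heq)))
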